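/- Let $l\ge 0$ and $N_1,\ldots,N_l\ge 1$ be integers, and set $N=N_1+\cdots+N_l$. Let $\Gamma$ be one of the two groups $\mathbb Z_{N_1}\times\cdots\times\mathbb Z_{N_l}$ and $\mathbb Z_{N_1}*\cdots*\mathbb Z_{N_l}$, and let $C^*(\Gamma)$ be its full group $C^*$-algebra. Decompose $\{1,\ldots,N\}=A_1\sqcup\cdots\sqcup A_l$ with $|A_r|=N_r$, and label the elements of $A_r$ by the residues modulo $N_r$. The dual $\widehat\Gamma$ is regarded as a quantum permutation group, $\widehat\Gamma\subset S_N^+$, via the block diagonal magic unitary $u=(u_{ij})\in M_N(C^*(\Gamma))$ given by $u_{ij}=0$ if $i,j$ belong to different sets $A_r$, and by $$u_{ij}=\frac{1}{N_r}\sum_{k\in\mathbb Z_{N_r}}e^{2\pi\mathrm{i}(i-j)k/N_r}\,g^{(r)}_k\qquad\text{for } i,j\in A_r,$$ where $g^{(r)}_k\in\Gamma\subset C^*(\Gamma)$ is the image of $k$ under the canonical embedding $\mathbb Z_{N_r}\to\Gamma$. For $k\in\mathbb N$, write $(i_1,\ldots,i_k)\sim_k(j_1,\ldots,j_k)$ when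 $u_{i_1j_1}\cdots u_{i_kj_k}\ne 0$ in $C^*(\Gamma)$. (1) For both groups, and for every $k$, the relation $\sim_k$ on $\{1,\ldots,N\}^k$ is transitive, and is in fact an equivalence relation. Its classes are called the (algebraic) $k$-orbitals of $\widehat\Gamma$. (2) If at least two of the numbers $N_1,\ldots,N_l$ are $\ge 2$, the quantum groups $\widehat{\mathbb Z_{N_1}\times\cdots\times\mathbb Z_{N_l}}$ and $\widehat{\mathbb Z_{N_1}*\cdots*\mathbb Z_{N_l}}$ are distinguished by their $3$-orbitals: the two collections of $3$-orbitals are different, and the second quantum group has strictly fewer $3$-orbitals than the first one. -/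

import Mathlib

open scoped ENNReal

universe u v w

noncomputable section

/-- The C⋆-subalgebra generated by `S`: the closure of the ⋆-subalgebra generated by `S`. -/
def cstarSpan {A : Type w} [CStarAlgebra A] (S : Set A) : StarSubalgebra ℂ A :=
  (StarAlgebra.adjoin ℂ S).topologicalClosure

/-- The set `S` generates the C⋆-algebra `A`. -/
def GeneratesCStar {A : Type w} [CStarAlgebra A] (S : Set A) : Prop :=
  cstarSpan S = ⊤

theorem GeneratesCStar.of_subset {A : Type w} [CStarAlgebra A] {S T : Set A}
    (hT : GeneratesCStar T) (h : T ⊆ StarAlgebra.adjoin ℂ S) : GeneratesCStar S :=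
  eq_top_iff.2 (hT.ge.trans
    (StarSubalgebra.topologicalClosure_mono (StarAlgebra.adjoin_le h)))

theorem GeneratesCStar.of_incl {A : Type v} {B : Type w} [CStarAlgebra A] [CStarAlgebra B]
    (f : A →⋆ₐ[ℂ] B) (hf : Topology.IsInducing f) (S : Set A)
    (h : ∀ x, f x ∈ cstarSpan (f '' S)) : GeneratesCStar S := by
  refine eq_top_iff.2 fun x _ => ?_
  have hx := h x
  rw [cstarSpan, ← StarAlgHom.map_adjoin] at hx
  change x ∈ closure _
  rw [hf.closure_eq_preimage_closure_image]
  exact hx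

/-! ### The full group C⋆-algebra of a discrete group -/

/-- A unitary representation of the discrete group `Γ` on a nonzero complex Hilbert space.
(Every cyclic representation of `Γ` lives, up to unitary equivalence, in the universe of `Γ`.) -/
structure UnitaryRep (Γ : Type u) [Group Γ] : Type (u + 1) where
  /-- the Hilbert space -/
  H : Type u
  [normed : NormedAddCommGroup H]
  [inner : InnerProductSpace ℂ H]
  [complete : CompleteSpace H]
  [nontrivial : Nontrivial H]
  /-- the action by unitary operators -/
  toHom : Γ →* unitary (H →L[ℂ] H)

attribute [instance] UnitaryRep.normed UnitaryRep.inner UnitaryRep.complete UnitaryRep.nontrivial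

namespace GroupCStar

variable (Γ : Type u) [Group Γ]

/-- The algebra `B(H_ρ)` of bounded operators on the space of the representation `ρ`. -/
abbrev Op (ρ : UnitaryRep Γ) : Type u := ρ.H →L[ℂ] ρ.H

/-- The C⋆-algebra `∏_ρ B(H_ρ)` of bounded families of operators, indexed by all the unitary
representations of `Γ`, with the supremum norm. -/
def Ambient : Type (u + 1) := lp (Op Γ) ∞

/-- The C⋆-algebra structure of `∏_ρ B(H_ρ)`, with componentwise operations. -/
def ambientCStarAlgebra : CStarAlgebra (lp (Op Γ) ∞) where

instance : CStarAlgebra (Ambient Γ) := ambientCStarAlgebra Γ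

variable {Γ}

/-- The universal unitary representation: it sends `g` to the family `(ρ(g))_ρ`. -/
def univ : Γ →* Ambient Γ where
  toFun g := ⟨fun ρ => (ρ.toHom g : Op Γ ρ), memℓp_infty ⟨1, by
    rintro _ ⟨ρ, rfl⟩
    exact (CStarRing.norm_of_mem_unitary (ρ.toHom g).2).le⟩⟩
  map_one' := by
    refine Subtype.ext (funext fun ρ => ?_)
    change (ρ.toHom 1 : Op Γ ρ) = 1
    simp
  map_mul' g h := by
    refine Subtype.ext (funext fun ρ => ?_)
    change (ρ.toHom (g * h) : Op Γ ρ) = ρ.toHom g * ρ.toHom h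
    simp

theorem star_univ (g : Γ) : star (univ g) = univ g⁻¹ := by
  refine Subtype.ext (funext fun ρ => ?_)
  change star (ρ.toHom g : Op Γ ρ) = (ρ.toHom g⁻¹ : Op Γ ρ)
  rw [map_inv]
  rfl

variable (Γ)

/-- The closed ⋆-subalgebra generated by the universal unitary representation. -/
def closedSpan : StarSubalgebra ℂ (Ambient Γ) :=
  cstarSpan (Set.range (univ : Γ → Ambient Γ))

end GroupCStar

/-- The full group C⋆-algebra `C⋆(Γ)`: the completion of the group algebra `ℂ[Γ]` for the norm
`‖a‖ = sup_ρ ‖ρ(a)‖`, over all unitary representations `ρ`, realized as the closed linear span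
of the universal representation. -/
def GroupCStar (Γ : Type u) [Group Γ] : Type (u + 1) := GroupCStar.closedSpan Γ

namespace GroupCStar

variable {Γ : Type u} [Group Γ]

/-- The C⋆-algebra structure of `C⋆(Γ)`, inherited from `∏_ρ B(H_ρ)`. -/
def cstarAlgebra (Γ : Type u) [Group Γ] : CStarAlgebra (GroupCStar Γ) :=
  StarSubalgebra.cstarAlgebra (closedSpan Γ)
    (h_closed := StarSubalgebra.isClosed_topologicalClosure _)

instance : CStarAlgebra (GroupCStar Γ) := cstarAlgebra Γ

/-- The inclusion of `C⋆(Γ)` into the product of the algebras `B(H_ρ)`. -/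
def incl : GroupCStar Γ →⋆ₐ[ℂ] Ambient Γ := (closedSpan Γ).subtype

theorem incl_injective : Function.Injective (incl : GroupCStar Γ → Ambient Γ) :=
  Subtype.val_injective

theorem incl_isInducing : Topology.IsInducing (incl : GroupCStar Γ → Ambient Γ) :=
  Topology.IsInducing.subtypeVal

/-- The group elements, as elements of `C⋆(Γ)`. -/
def of : Γ →* GroupCStar Γ where
  toFun g := ⟨univ g, StarSubalgebra.le_topologicalClosure _
    (StarAlgebra.subset_adjoin ℂ _ ⟨g, rfl⟩)⟩
  map_one' := Subtype.ext (map_one univ)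
  map_mul' g h := Subtype.ext (map_mul univ g h)

theorem incl_of (g : Γ) : incl (of g) = univ g := rfl

theorem star_of (g : Γ) : star (of g : GroupCStar Γ) = of g⁻¹ :=
  incl_injective (by rw [map_star, incl_of, incl_of, star_univ])

theorem incl_mem (x : GroupCStar Γ) : incl x ∈ closedSpan Γ := x.2

theorem generates_of : GeneratesCStar (Set.range (of : Γ → GroupCStar Γ)) := by
  refine GeneratesCStar.of_incl incl incl_isInducing _ fun x => ?_
  have h : incl '' Set.range (of : Γ → GroupCStar Γ) = Set.range (univ : Γ → Ambient Γ) := by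
    rw [← Set.range_comp]
    exact congrArg Set.range (funext incl_of)
  rw [h]
  exact incl_mem x

end GroupCStar

/-! ### Magic unitaries and the relations `∼_k` -/

/-- A magic unitary over the C⋆-algebra `A`, with rows and columns labelled by the finite set `X`:
a square matrix of projections, summing up to `1` on each row and each column, whose entries
generate `A`. A closed subgroup of the quantum permutation group of `X` is given by
`A = C(G)` together with such a matrix. -/
structure MagicUnitary (X : Type v) [Fintype X] (A : Type w) [CStarAlgebra A] where
  /-- the matrix of coordinates -/
  mat : Matrix X X A
  isStarProjection : ∀ i j, IsStarProjection (mat i j)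
  row_sum : ∀ i, ∑ j, mat i j = 1
  col_sum : ∀ j, ∑ i, mat i j = 1
  generates : GeneratesCStar (Set.range fun p : X × X => mat p.1 p.2)

namespace MagicUnitary

variable {X : Type v} [Fintype X] {A : Type w} [CStarAlgebra A] (U : MagicUnitary X A)

/-- The relation `(i₁,…,i_k) ∼_k (j₁,…,j_k)`: the ordered product `u_{i₁j₁} ⋯ u_{i_kj_k}` is
nonzero. -/
def Rel (k : ℕ) (i j : Fin k → X) : Prop :=
  (List.ofFn fun a => U.mat (i a) (j a)).prod ≠ 0

/-- The classes of the relation `∼_k`; when `∼_k` is an equivalence relation, these are the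
(algebraic) `k`-orbitals. -/
def orbitals (k : ℕ) : Set (Set (Fin k → X)) :=
  Set.range fun i => {j | U.Rel k i j}

end MagicUnitary

/-! ### The cyclic groups -/

section Cyclic

variable {n : ℕ} [NeZero n] {A : Type w} [CStarAlgebra A]

/-- The matrix `u_{ij} = (1/n) ∑_k w^{(i-j)k} g_k`, where `w = exp(2πi/n)` and where `g_k ∈ A` is
the image of `k ∈ ℤ_n`. Here `ZMod.stdAddChar` is the character `a ↦ w^a` of `ℤ_n`. -/
def cyclicMatrix (g : Multiplicative (ZMod n) →* A) : Matrix (ZMod n) (ZMod n) A :=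
  fun i j => (n : ℂ)⁻¹ • ∑ k : ZMod n,
    (ZMod.stdAddChar ((i - j) * k) : ℂ) • g (Multiplicative.ofAdd k)

variable (g : Multiplicative (ZMod n) →* A)

theorem cyclicMatrix_eq (i j : ZMod n) : cyclicMatrix g i j = cyclicMatrix g (i - j) 0 := by
  simp [cyclicMatrix]

theorem cyclicMatrix_star (hg : ∀ x, star (g x) = g x⁻¹) (i j : ZMod n) :
    star (cyclicMatrix g i j) = cyclicMatrix g i j := by
  simp only [cyclicMatrix, star_smul, star_sum, hg]
  congr 1
  · simp
  · refine Fintype.sum_equiv (Equiv.neg _) _ _ fun k => ?_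
    simp only [Equiv.neg_apply, mul_neg, ofAdd_neg]
    congr 1
    rw [AddChar.map_neg_eq_conj]
    rfl

theorem cyclicMatrix_mul_self (i j : ZMod n) :
    cyclicMatrix g i j * cyclicMatrix g i j = cyclicMatrix g i j := by
  have hN : (n : ℂ) ≠ 0 := Nat.cast_ne_zero.2 (NeZero.ne _)
  have key : ∀ m : ZMod n,
      (ZMod.stdAddChar ((i - j) * m) : ℂ) • g (Multiplicative.ofAdd m) *
      ∑ k : ZMod n, (ZMod.stdAddChar ((i - j) * k) : ℂ) • g (Multiplicative.ofAdd k) =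
      ∑ k : ZMod n, (ZMod.stdAddChar ((i - j) * k) : ℂ) • g (Multiplicative.ofAdd k) := by
    intro m
    rw [Finset.mul_sum]
    refine Fintype.sum_equiv (Equiv.addLeft m) _ _ fun k => ?_
    rw [Equiv.coe_addLeft, ofAdd_add, map_mul g, mul_add, AddChar.map_add_eq_mul,
      smul_mul_smul_comm]
  simp only [cyclicMatrix, smul_mul_smul_comm]
  rw [Finset.sum_mul, Finset.sum_congr rfl fun m _ => key m, Finset.sum_const, Finset.card_univ,
    ZMod.card, ← Nat.cast_smul_eq_nsmul ℂ, smul_smul]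
  congr 1
  field_simp

/-- Fourier inversion. -/
theorem sum_cyclicMatrix (k : ZMod n) :
    ∑ a : ZMod n, (ZMod.stdAddChar (a * -k) : ℂ) • cyclicMatrix g a 0 =
      g (Multiplicative.ofAdd k) := by
  have hN : (n : ℂ) ≠ 0 := Nat.cast_ne_zero.2 (NeZero.ne _)
  have h1 : ∀ a : ZMod n, (ZMod.stdAddChar (a * -k) : ℂ) • cyclicMatrix g a 0 =
      ∑ m : ZMod n, ((n : ℂ)⁻¹ * ZMod.stdAddChar (a * (m - k))) •
        g (Multiplicative.ofAdd m) := by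
    intro a
    simp only [cyclicMatrix, sub_zero, Finset.smul_sum, smul_smul]
    refine Finset.sum_congr rfl fun m _ => ?_
    congr 1
    rw [sub_eq_add_neg, mul_add, AddChar.map_add_eq_mul]
    ring
  rw [Finset.sum_congr rfl fun a _ => h1 a, Finset.sum_comm]
  simp only [← Finset.sum_smul, ← Finset.mul_sum,
    AddChar.sum_mulShift _ (ZMod.isPrimitive_stdAddChar n), ZMod.card]
  rw [Finset.sum_eq_single k]
  · simp [hN]
  · intro m _ hm
    simp [sub_ne_zero.2 hm]
  · simp

theorem sum_cyclicMatrix_zero : ∑ a : ZMod n, cyclicMatrix g a 0 = 1 := by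
  simpa using sum_cyclicMatrix g 0

end Cyclic

/-! ### The group duals -/

namespace GroupDual

variable {l : ℕ} (N : Fin l → ℕ)

/-- The free product `ℤ_{N₁} * ⋯ * ℤ_{N_l}`. -/
abbrev FreeProd : Type := Monoid.CoprodI fun r => Multiplicative (ZMod (N r))

/-- The direct product `ℤ_{N₁} × ⋯ × ℤ_{N_l}`. -/
abbrev DirectProd : Type := ∀ r, Multiplicative (ZMod (N r))

/-- The canonical quotient map `ℤ_{N₁} * ⋯ * ℤ_{N_l} → ℤ_{N₁} × ⋯ × ℤ_{N_l}`. -/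
def freeToDirect : FreeProd N →* DirectProd N :=
  Monoid.CoprodI.lift fun r => MonoidHom.mulSingle (fun r => Multiplicative (ZMod (N r))) r

theorem freeToDirect_surjective : Function.Surjective (freeToDirect N) := by
  intro x
  have h : x ∈ (freeToDirect N).range := by
    refine Subgroup.pi_mem_of_mulSingle_mem x fun r => ?_
    exact ⟨Monoid.CoprodI.of (x r), by simp [freeToDirect]⟩
  exact h

/-- The set of `N₁ + ⋯ + N_l` points, as the disjoint union of the blocks `A_r`, with `A_r`
labelled by the residues modulo `N_r`. -/
abbrev Pts : Type := Σ r, ZMod (N r)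

variable {N} {Γ : Type u} [Group Γ]

/-- The group morphism `ℤ_{N_r} → Γ ⊂ C⋆(Γ)` associated to a quotient
`π : ℤ_{N₁} * ⋯ * ℤ_{N_l} → Γ`. -/
def gen (π : FreeProd N →* Γ) (r : Fin l) : Multiplicative (ZMod (N r)) →* GroupCStar Γ :=
  GroupCStar.of.comp
    (π.comp (Monoid.CoprodI.of (M := fun r => Multiplicative (ZMod (N r))) (i := r)))

theorem star_gen (π : FreeProd N →* Γ) (r : Fin l) (x : Multiplicative (ZMod (N r))) :
    star (gen π r x) = gen π r x⁻¹ := by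
  simp only [gen, MonoidHom.comp_apply, GroupCStar.star_of, map_inv]

variable [∀ r, NeZero (N r)]

/-- The magic unitary of the dual of a quotient `π : ℤ_{N₁} * ⋯ * ℤ_{N_l} → Γ`: it is block
diagonal, the blocks being the matrices associated to the subgroups `ℤ_{N_r} → Γ`. -/
def magic (π : FreeProd N →* Γ) (hπ : Function.Surjective π) :
    MagicUnitary (Pts N) (GroupCStar Γ) where
  mat := Matrix.blockDiagonal' fun r => cyclicMatrix (gen π r)
  isStarProjection := by
    rintro ⟨r, i⟩ ⟨s, j⟩
    by_cases h : r = s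
    · subst h
      rw [Matrix.blockDiagonal'_apply_eq]
      exact ⟨cyclicMatrix_mul_self _ i j, cyclicMatrix_star _ (star_gen π r) i j⟩
    · rw [Matrix.blockDiagonal'_apply_ne _ _ _ h]
      exact .zero _
  row_sum := by
    rintro ⟨r, i⟩
    rw [Fintype.sum_sigma, Finset.sum_eq_single r]
    · simp only [Matrix.blockDiagonal'_apply_eq]
      rw [← sum_cyclicMatrix_zero (gen π r)]
      exact Fintype.sum_equiv (Equiv.subLeft i) _ _ fun j => cyclicMatrix_eq _ i j
    · intro s _ hs
      exact Finset.sum_eq_zero fun j _ => Matrix.blockDiagonal'_apply_ne _ _ _ hs.symm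
    · simp
  col_sum := by
    rintro ⟨r, j⟩
    rw [Fintype.sum_sigma, Finset.sum_eq_single r]
    · simp only [Matrix.blockDiagonal'_apply_eq]
      rw [← sum_cyclicMatrix_zero (gen π r)]
      exact Fintype.sum_equiv (Equiv.subRight j) _ _ fun i => cyclicMatrix_eq _ i j
    · intro s _ hs
      exact Finset.sum_eq_zero fun i _ => Matrix.blockDiagonal'_apply_ne _ _ _ hs
    · simp
  generates := by
    refine GroupCStar.generates_of.of_subset ?_
    rintro _ ⟨g, rfl⟩
    obtain ⟨x, rfl⟩ := hπ g
    induction x using Monoid.CoprodI.induction_on with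
    | one => rw [map_one, map_one]; exact one_mem _
    | of r k =>
      have := sum_cyclicMatrix (gen π r) (Multiplicative.toAdd k)
      rw [ofAdd_toAdd] at this
      change gen π r k ∈ _
      rw [← this]
      refine sum_mem fun a _ => SMulMemClass.smul_mem _ (StarAlgebra.subset_adjoin ℂ _ ?_)
      exact ⟨(⟨r, a⟩, ⟨r, 0⟩), Matrix.blockDiagonal'_apply_eq _ _ _ _⟩
    | mul x y hx hy => rw [map_mul, map_mul]; exact mul_mem hx hy

variable (N)

/-- The dual of `ℤ_{N₁} * ⋯ * ℤ_{N_l}`, as a quantum permutation group. -/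
def free : MagicUnitary (Pts N) (GroupCStar (FreeProd N)) :=
  magic (MonoidHom.id (FreeProd N)) Function.surjective_id

/-- The dual of `ℤ_{N₁} × ⋯ × ℤ_{N_l}`, as a quantum permutation group. -/
def direct : MagicUnitary (Pts N) (GroupCStar (DirectProd N)) :=
  magic (freeToDirect N) (freeToDirect_surjective N)

end GroupDual

end

noncomputable section

/-! ### Spectral projections of a cyclic group -/

section Cyclic

variable {n : ℕ} [NeZero n] {A : Type w} [CStarAlgebra A] (g : Multiplicative (ZMod n) →* A)

/-! An entry `u_{ij}` inside the block `A_r` is the spectral projection of the generator of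
`ℤ_{N_r}` indexed by `i - j`, so whether `u_{i₁j₁} ⋯ u_{i_kj_k}` vanishes depends only on the blocks
visited and on the differences `i_p - j_p`. For the direct product the projections commute, and the
product is nonzero iff the differences agree within each block: a suitable character detects it
(`prod_proj_direct_ne_zero_iff`). For the free product, blocks of size one contribute the factor
`1`; once they are deleted, only neighbours in the same block must have equal differences. Necessity
is orthogonality; sufficiency follows from a longest reduced word in the regular representation
(`exists_coeff_ne_zero`). In both cases the admissible differences form a subgroup depending only on
the blocks, which yields an equivalence relation (`linkedRel_equivalence`). The free relation is
coarser, strictly so on triples visiting blocks `r, s, r`, hence it has fewer classes. -/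

theorem gen_mul_cyclicMatrix (m b : ZMod n) :
    g (Multiplicative.ofAdd m) * cyclicMatrix g b 0 =
      (ZMod.stdAddChar (-(b * m)) : ℂ) • cyclicMatrix g b 0 := by
  simp only [cyclicMatrix, sub_zero, mul_smul_comm, Finset.mul_sum]
  rw [smul_comm]
  congr 1
  rw [Finset.smul_sum]
  refine Fintype.sum_equiv (Equiv.addLeft m) _ _ fun k => ?_
  rw [Equiv.coe_addLeft, ofAdd_add, map_mul g, smul_smul, ← AddChar.map_add_eq_mul]
  congr 3
  ring

/-- Every group element acts on the right factor by a scalar, so expanding the left factor leaves a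
sum of a nontrivial character over `ℤ_n`. -/
theorem cyclicMatrix_mul_of_ne {a b : ZMod n} (h : a ≠ b) :
    cyclicMatrix g a 0 * cyclicMatrix g b 0 = 0 := by
  rw [cyclicMatrix]
  simp only [sub_zero, smul_mul_assoc, Finset.sum_mul, gen_mul_cyclicMatrix, smul_smul,
    ← AddChar.map_add_eq_mul]
  rw [← Finset.sum_smul]
  have : ∑ k : ZMod n, (ZMod.stdAddChar (a * k + -(b * k)) : ℂ) = 0 := by
    have := AddChar.sum_mulShift (a - b) (ZMod.isPrimitive_stdAddChar n)
    rw [if_neg (sub_ne_zero.2 h), Nat.cast_zero] at this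
    rw [← this]
    exact Finset.sum_congr rfl fun k _ => by congr 1; ring
  rw [this, zero_smul, smul_zero]

theorem cyclicMatrix_eq_one (h : n = 1) (a : ZMod n) : cyclicMatrix g a 0 = 1 := by
  subst h
  rw [← sum_cyclicMatrix_zero g]
  exact (Fintype.sum_subsingleton (fun b => cyclicMatrix g b 0) a).symm

end Cyclic

/-! ### Evaluation of the group C⋆-algebra at a unitary representation -/

namespace GroupCStar

variable {Γ : Type u} [Group Γ]

/-- The extension to `C⋆(Γ)` of a unitary representation `ρ` of `Γ`. -/
def eval (ρ : UnitaryRep Γ) : GroupCStar Γ →ₐ[ℂ] (ρ.H →L[ℂ] ρ.H) where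
  toFun x := (incl x).1 ρ
  map_one' := rfl
  map_mul' _ _ := rfl
  map_zero' := rfl
  map_add' _ _ := rfl
  commutes' _ := rfl

theorem eval_of (ρ : UnitaryRep Γ) (g : Γ) : eval ρ (of g) = (ρ.toHom g : ρ.H →L[ℂ] ρ.H) := rfl

end GroupCStar

/-! ### Test representations: characters and the regular representation -/

namespace UnitaryRep

/-- The one-dimensional representation associated to a character. -/
def ofCharacter {Γ : Type} [Group Γ] (φ : Γ →* Circle) : UnitaryRep Γ where
  H := ℂ
  toHom :=
    { toFun g := ⟨algebraMap ℂ (ℂ →L[ℂ] ℂ) (φ g), by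
        rw [Unitary.mem_iff, ← algebraMap_star_comm, ← map_mul, ← map_mul]
        have h : star (φ g : ℂ) * φ g = 1 := by
          rw [Complex.star_def, ← Circle.coe_inv_eq_conj, ← Circle.coe_mul, inv_mul_cancel,
            Circle.coe_one]
        rw [mul_comm (φ g : ℂ), h, map_one]
        exact ⟨rfl, rfl⟩⟩
      map_one' := Subtype.ext (by simp)
      map_mul' g h := Subtype.ext (by simp) }

theorem ofCharacter_toHom {Γ : Type} [Group Γ] (φ : Γ →* Circle) (g : Γ) :
    ((ofCharacter φ).toHom g : (ofCharacter φ).H →L[ℂ] (ofCharacter φ).H) =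
      algebraMap ℂ _ (φ g : ℂ) := rfl

variable (Γ : Type u) [Group Γ]

variable {Γ} in
/-- Left translation by `g` on `ℓ²(Γ)`. -/
def leftTranslation (g : Γ) : lp (fun _ : Γ => ℂ) 2 ≃ₗᵢ[ℂ] lp (fun _ : Γ => ℂ) 2 :=
  have mem : ∀ (g : Γ) (f : lp (fun _ : Γ => ℂ) 2),
      Memℓp (E := fun _ : Γ => ℂ) (fun h => f (g⁻¹ * h)) 2 := fun g f => by
    have hf := lp.memℓp f
    rw [memℓp_gen_iff (by norm_num)] at hf ⊢
    exact (Equiv.mulLeft g⁻¹).summable_iff.2 hf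
  { toFun f := ⟨fun h => f (g⁻¹ * h), mem g f⟩
    invFun f := ⟨fun h => f (g⁻¹⁻¹ * h), mem g⁻¹ f⟩
    left_inv f := lp.ext (funext fun h => congrArg f (by group))
    right_inv f := lp.ext (funext fun h => congrArg f (by group))
    map_add' _ _ := rfl
    map_smul' _ _ := rfl
    norm_map' f := by
      have h2 : 0 < (2 : ℝ≥0∞).toReal := by norm_num
      rw [lp.norm_eq_tsum_rpow h2, lp.norm_eq_tsum_rpow h2]
      congr 1
      exact (Equiv.mulLeft g⁻¹).tsum_eq fun h => ‖f h‖ ^ (2 : ℝ≥0∞).toReal }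

theorem leftTranslation_apply (g : Γ) (f : lp (fun _ : Γ => ℂ) 2) (h : Γ) :
    leftTranslation g f h = f (g⁻¹ * h) := rfl

/-- The left regular representation. -/
def regular : UnitaryRep Γ where
  H := lp (fun _ : Γ => ℂ) 2
  nontrivial := by
    classical
    refine ⟨⟨0, lp.single 2 1 1, fun h => ?_⟩⟩
    have := congrArg (fun f : lp (fun _ : Γ => ℂ) 2 => f 1) h
    simp at this
  toHom := Unitary.linearIsometryEquiv.symm.toMonoidHom.comp
    { toFun := leftTranslation
      map_one' := LinearIsometryEquiv.ext fun f => lp.ext (funext fun h => by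
        rw [leftTranslation_apply]; simp)
      map_mul' g g' := LinearIsometryEquiv.ext fun f => lp.ext (funext fun h => by
        change f ((g * g')⁻¹ * h) = f (g'⁻¹ * (g⁻¹ * h))
        rw [mul_inv_rev, mul_assoc]) }

variable {Γ}

/-- The coefficient at `h` of the action of `a ∈ C⋆(Γ)` on `ℓ²(Γ)`, applied to `δ_1`. -/
def coeff (a : GroupCStar Γ) (h : Γ) : ℂ :=
  open Classical in
  let f : lp (fun _ : Γ => ℂ) 2 :=
    GroupCStar.eval (regular Γ) a (lp.single 2 1 1 : lp (fun _ : Γ => ℂ) 2)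
  f h

theorem coeff_zero (h : Γ) : coeff (0 : GroupCStar Γ) h = 0 := by
  rw [coeff, map_zero]; rfl

theorem coeff_smul (c : ℂ) (a : GroupCStar Γ) (h : Γ) : coeff (c • a) h = c * coeff a h := by
  rw [coeff, map_smul]; rfl

theorem coeff_add (a b : GroupCStar Γ) (h : Γ) : coeff (a + b) h = coeff a h + coeff b h := by
  rw [coeff, map_add]; rfl

theorem coeff_sum {ι : Type*} (s : Finset ι) (a : ι → GroupCStar Γ) (h : Γ) :
    coeff (∑ i ∈ s, a i) h = ∑ i ∈ s, coeff (a i) h :=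
  map_sum (⟨⟨fun x => coeff x h, coeff_zero h⟩, fun a b => coeff_add a b h⟩ :
    GroupCStar Γ →+ ℂ) a s

theorem coeff_of_mul (g : Γ) (a : GroupCStar Γ) (h : Γ) :
    coeff (GroupCStar.of g * a) h = coeff a (g⁻¹ * h) := by
  rw [coeff, map_mul]; rfl

open Classical in
theorem coeff_one (h : Γ) : coeff (1 : GroupCStar Γ) h = if h = 1 then 1 else 0 := by
  rw [coeff, map_one]
  change (lp.single 2 1 1 : lp (fun _ : Γ => ℂ) 2) h = _
  rw [lp.single_apply, Pi.single_apply]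

end UnitaryRep
end

noncomputable section

/-! ### Lengths of reduced words -/

namespace Monoid.CoprodI.Word

variable {ι : Type*} {G : ι → Type*} [∀ i, Group (G i)] [∀ i, DecidableEq (G i)]

theorem length_rcons_le {i : ι} (p : Pair G i) :
    (rcons p).toList.length ≤ p.tail.toList.length + 1 := by
  unfold rcons
  split_ifs <;> simp [cons]

theorem length_tail_le_rcons {i : ι} (p : Pair G i) :
    p.tail.toList.length ≤ (rcons p).toList.length := by
  unfold rcons
  split_ifs <;> simp [cons]

/-- Multiplying by an element of one factor alters only the first letter in that factor, so it
shortens a reduced word by at most one. -/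
theorem length_le_smul [DecidableEq ι] {i : ι} (m : G i) (w : Word G) :
    w.toList.length ≤ (of m • w).toList.length + 1 := by
  have h1 : rcons (equivPair i w) = w := (equivPair i).symm_apply_apply w
  have h2 := length_rcons_le (equivPair i w)
  rw [h1] at h2
  rw [of_smul_def]
  exact h2.trans (Nat.succ_le_succ (length_tail_le_rcons
    { equivPair i w with head := m * (equivPair i w).head }))

end Monoid.CoprodI.Word

/-! ### Products of spectral projections for the free product -/

namespace GroupDual

open Monoid.CoprodI UnitaryRep

variable {l : ℕ} {N : Fin l → ℕ} [∀ r, NeZero (N r)] {Γ : Type u} [Group Γ]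

/-- The spectral projections of the generators of the groups `ℤ_{N_r}`. -/
def proj (π : FreeProd N →* Γ) (x : Pts N) : GroupCStar Γ := cyclicMatrix (gen π x.1) x.2 0

theorem proj_mul_self (π : FreeProd N →* Γ) (x : Pts N) : proj π x * proj π x = proj π x :=
  cyclicMatrix_mul_self _ _ _

theorem proj_mul_of_ne (π : FreeProd N →* Γ) {x y : Pts N} (h : x.1 = y.1) (hxy : x ≠ y) :
    proj π x * proj π y = 0 := by
  obtain ⟨r, a⟩ := x
  obtain ⟨s, b⟩ := y
  obtain rfl : r = s := h
  exact cyclicMatrix_mul_of_ne _ fun h => hxy (congrArg (Sigma.mk r) h)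

theorem proj_eq_one (π : FreeProd N →* Γ) {x : Pts N} (h : N x.1 = 1) : proj π x = 1 :=
  cyclicMatrix_eq_one _ h _

/-- The compatibility condition on two spectral projections: they are not distinct spectral
projections of the same generator. -/
def Compat (x y : Pts N) : Prop := x.1 = y.1 → x = y

theorem coeff_proj_mul (π : FreeProd N →* Γ) (x : Pts N) (a : GroupCStar Γ) (g : Γ) :
    coeff (proj π x * a) g = (N x.1 : ℂ)⁻¹ * ∑ k : ZMod (N x.1),
      (ZMod.stdAddChar (x.2 * k) : ℂ) * coeff a ((π (of (Multiplicative.ofAdd k)))⁻¹ * g) := by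
  simp only [proj, cyclicMatrix, sub_zero, smul_mul_assoc, Finset.sum_mul, coeff_smul, coeff_sum]
  exact congrArg _ (Finset.sum_congr rfl fun k _ => congrArg _ (coeff_of_mul _ _ _))

/-- The word `w` has maximal length in the support of the product. Recording its first block and the
vanishing on longer words is what lets the induction on `L` close. -/
theorem exists_coeff_ne_zero (L : List (Pts N)) (hL : ∀ x ∈ L, N x.1 ≠ 1)
    (hc : L.IsChain Compat) :
    ∃ w : Word fun r => Multiplicative (ZMod (N r)), w.fstIdx = L.head?.map Sigma.fst ∧
      coeff (L.map (proj (MonoidHom.id (FreeProd N)))).prod w.prod ≠ 0 ∧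
      ∀ w' : Word fun r => Multiplicative (ZMod (N r)), w.toList.length < w'.toList.length →
        coeff (L.map (proj (MonoidHom.id (FreeProd N)))).prod w'.prod = 0 := by
  induction L with
  | nil =>
    refine ⟨Word.empty, rfl, ?_, fun w' h => ?_⟩
    · rw [List.map_nil, List.prod_nil, coeff_one, if_pos Word.prod_empty]
      exact one_ne_zero
    · rw [List.map_nil, List.prod_nil, coeff_one, if_neg]
      intro h1
      rw [← Word.prod_empty] at h1
      obtain rfl : w' = Word.empty := Word.equiv.symm.injective h1
      exact lt_irrefl _ h
  | cons x L ih =>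
    obtain ⟨w, hw, hne, hz⟩ := ih (fun y hy => hL y (List.mem_cons_of_mem _ hy)) hc.tail
    set a := (L.map (proj (MonoidHom.id (FreeProd N)))).prod with ha
    rw [List.map_cons, List.prod_cons, ← ha, List.head?_cons, Option.map_some]
    by_cases hx : w.fstIdx = some x.1
    · refine ⟨w, hx, ?_⟩
      -- Here `w` starts in the block of `x`, so compatibility forces `x` to be the head of `L`, and
      -- idempotency absorbs it.
      have : proj (MonoidHom.id (FreeProd N)) x * a = a := by
        cases L with
        | nil => rw [hw] at hx; cases hx
        | cons y L =>
          rw [hw, List.head?_cons, Option.map_some, Option.some.injEq] at hx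
          obtain rfl : x = y := (List.isChain_cons_cons.1 hc).1 hx.symm
          rw [ha, List.map_cons, List.prod_cons, ← mul_assoc, proj_mul_self]
      rw [this]
      exact ⟨hne, hz⟩
    · have hN : (N x.1 : ℂ) ≠ 0 := Nat.cast_ne_zero.2 (NeZero.ne _)
      have h1 : Multiplicative.ofAdd (1 : ZMod (N x.1)) ≠ 1 := by
        have : Fact (1 < N x.1) := ⟨lt_of_le_of_ne (Nat.pos_of_ne_zero (NeZero.ne _))
          (hL x List.mem_cons_self).symm⟩
        exact fun h => one_ne_zero (α := ZMod (N x.1)) (Multiplicative.ofAdd.injective h)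
      -- The new word is `w` with a letter of the block of `x` prepended; any nontrivial letter
      -- would do.
      refine ⟨Word.cons (Multiplicative.ofAdd (1 : ZMod (N x.1))) w hx h1,
        Word.fstIdx_cons _ _ _ _, ?_, fun w' h => ?_⟩
      -- Only `k = 1` cancels the new letter and returns to `w`; any other `k` leaves a word longer
      -- than `w`, where the coefficient of `a` is zero.
      · rw [coeff_proj_mul, Finset.sum_eq_single 1]
        · rw [Word.prod_cons, MonoidHom.id_apply, inv_mul_cancel_left]
          refine mul_ne_zero (inv_ne_zero hN) (mul_ne_zero ?_ hne)
          exact (AddChar.val_isUnit _ _).ne_zero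
        · intro k _ hk
          have hk' : (Multiplicative.ofAdd k)⁻¹ * Multiplicative.ofAdd (1 : ZMod (N x.1)) ≠ 1 :=
            fun h => hk (Multiplicative.ofAdd.injective (inv_mul_eq_one.1 h))
          rw [Word.prod_cons, MonoidHom.id_apply, ← map_inv, ← mul_assoc, ← map_mul,
            ← Word.prod_cons _ _ _ hk' hx, hz, mul_zero]
          exact Nat.lt_succ_self _
        · simp
      · rw [coeff_proj_mul]
        refine mul_eq_zero_of_right _ (Finset.sum_eq_zero fun k _ => mul_eq_zero_of_right _ ?_)
        rw [MonoidHom.id_apply, ← map_inv, ← Word.prod_smul]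
        refine hz _ (Nat.lt_of_succ_lt_succ (lt_of_lt_of_le ?_ (Word.length_le_smul _ w')))
        exact h

/-- A product of spectral projections in `C⋆(ℤ_{N₁} * ⋯ * ℤ_{N_l})` is nonzero if and only if,
once the trivial factors are removed, any two consecutive terms are compatible. -/
theorem prod_proj_free_ne_zero_iff (L : List (Pts N)) :
    (L.map (proj (MonoidHom.id (FreeProd N)))).prod ≠ 0 ↔
      (L.filter fun x => N x.1 ≠ 1).IsChain Compat := by
  have hf : (L.map (proj (MonoidHom.id (FreeProd N)))).prod =
      ((L.filter fun x => N x.1 ≠ 1).map (proj (MonoidHom.id (FreeProd N)))).prod := by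
    induction L with
    | nil => rfl
    | cons x L ih =>
      by_cases hx : N x.1 = 1
      · simp [hx, proj_eq_one, ih]
      · simp [hx, ih]
  rw [hf]
  constructor
  · intro h
    refine List.isChain_iff_forall_rel_of_append_cons_cons.2 fun x y A B hAB hxy => ?_
    by_contra hne
    rw [hAB, List.map_append, List.map_cons, List.map_cons, List.prod_append, List.prod_cons,
      List.prod_cons, ← mul_assoc (proj _ x), proj_mul_of_ne _ hxy hne, zero_mul, mul_zero] at h
    exact h rfl
  · intro h h0
    obtain ⟨w, -, hw, -⟩ := exists_coeff_ne_zero _ (fun x hx => by simpa using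
      (List.mem_filter.1 hx).2) h
    rw [h0, coeff_zero] at hw
    exact hw rfl

end GroupDual
end

noncomputable section

namespace GroupDual

open UnitaryRep

variable {l : ℕ} {N : Fin l → ℕ}

section

variable [∀ r, NeZero (N r)]

/-! ### Products of spectral projections for the direct product -/

theorem proj_direct_commute (x y : Pts N) :
    Commute (proj (freeToDirect N) x) (proj (freeToDirect N) y) := by
  unfold proj cyclicMatrix
  refine (Commute.sum_left _ _ _ fun a _ => ?_).smul_left _
  refine (Commute.sum_right _ _ _ fun b _ => ?_).smul_right _
  refine (Commute.smul_left ?_ _).smul_right _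
  exact (Commute.all (S := DirectProd N) _ _).map GroupCStar.of

theorem proj_mul_prod_direct_of_mem {x : Pts N} {L : List (Pts N)} (hx : x ∈ L) :
    proj (freeToDirect N) x * (L.map (proj (freeToDirect N))).prod =
      (L.map (proj (freeToDirect N))).prod := by
  induction L with
  | nil => cases hx
  | cons y L ih =>
    rw [List.map_cons, List.prod_cons]
    rcases List.mem_cons.1 hx with rfl | hx
    · rw [← mul_assoc, proj_mul_self]
    · rw [(proj_direct_commute x y).left_comm, ih hx]

/-- The values of `φ` cancel the Fourier coefficients of the projection, leaving the average of `N
x.1` ones. -/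
theorem eval_proj_ofCharacter (φ : DirectProd N →* Circle) (x : Pts N)
    (hφ : ∀ k : ZMod (N x.1), (φ (Pi.mulSingle x.1 (Multiplicative.ofAdd k)) : ℂ) =
      ZMod.stdAddChar (-(x.2 * k))) :
    GroupCStar.eval (ofCharacter φ) (proj (freeToDirect N) x) = 1 := by
  have hN : (N x.1 : ℂ) ≠ 0 := Nat.cast_ne_zero.2 (NeZero.ne _)
  have hg : ∀ k : ZMod (N x.1), GroupCStar.eval (ofCharacter φ)
      (gen (freeToDirect N) x.1 (Multiplicative.ofAdd k)) =
      (ZMod.stdAddChar (-(x.2 * k)) : ℂ) • 1 := fun k => by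
    rw [← hφ k, ← Algebra.algebraMap_eq_smul_one, ← ofCharacter_toHom, ← GroupCStar.eval_of]
    simp [gen, freeToDirect]
  simp only [proj, cyclicMatrix, sub_zero, map_smul, map_sum, hg, smul_smul,
    ← AddChar.map_add_eq_mul, add_neg_cancel, AddChar.map_zero_eq_one, one_smul,
    Finset.sum_const, Finset.card_univ, ZMod.card]
  rw [← Nat.cast_smul_eq_nsmul ℂ, smul_smul, inv_mul_cancel₀ hN, one_smul]

/-- A product of spectral projections in `C⋆(ℤ_{N₁} × ⋯ × ℤ_{N_l})` is nonzero if and only if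
any two of its factors are compatible. -/
theorem prod_proj_direct_ne_zero_iff (L : List (Pts N)) :
    (L.map (proj (freeToDirect N))).prod ≠ 0 ↔ ∀ x ∈ L, ∀ y ∈ L, Compat x y := by
  constructor
  · intro h x hx y hy hxy
    by_contra hne
    rw [← proj_mul_prod_direct_of_mem hx, ← proj_mul_prod_direct_of_mem hy, ← mul_assoc,
      proj_mul_of_ne _ hxy hne, zero_mul] at h
    exact h rfl
  · intro h
    -- Compatibility gives each block at most one value in `L`; blocks not visited get the value
    -- `0`.
    obtain ⟨c, hc⟩ : ∃ c : ∀ r, ZMod (N r), ∀ x ∈ L, x.2 = c x.1 := by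
      classical
      refine ⟨fun r => if hr : ∃ a, (⟨r, a⟩ : Pts N) ∈ L then hr.choose else 0, ?_⟩
      rintro ⟨r, a⟩ hx
      have hr : ∃ a, (⟨r, a⟩ : Pts N) ∈ L := ⟨a, hx⟩
      simp only [dif_pos hr]
      exact eq_of_heq (Sigma.mk.inj (h _ hx _ hr.choose_spec rfl)).2
    let φ : DirectProd N →* Circle :=
      { toFun x := ∏ r, ZMod.toCircle (-(c r * Multiplicative.toAdd (x r)))
        map_one' := by simp
        map_mul' x y := by
          rw [← Finset.prod_mul_distrib]
          refine Finset.prod_congr rfl fun r _ => ?_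
          rw [← AddChar.map_add_eq_mul]
          congr 1
          rw [Pi.mul_apply, toAdd_mul]
          ring }
    have hφ : ∀ (r : Fin l) (k : ZMod (N r)), φ (Pi.mulSingle r (Multiplicative.ofAdd k)) =
        ZMod.toCircle (-(c r * k)) := fun r k => by
      change ∏ s, ZMod.toCircle (-(c s * Multiplicative.toAdd _)) = _
      rw [Finset.prod_eq_single r]
      · simp
      · intro s _ hs
        simp [Pi.mulSingle_eq_of_ne hs]
      · simp
    intro h0
    have h1 := congrArg (GroupCStar.eval (ofCharacter φ)) h0
    rw [map_list_prod, List.map_map, List.prod_eq_one, map_zero] at h1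
    · exact one_ne_zero h1
    · intro z hz
      obtain ⟨x, hx, rfl⟩ := List.mem_map.1 hz
      refine eval_proj_ofCharacter φ x fun k => ?_
      rw [hφ, hc x hx]
      rfl

end

/-! ### The relations `∼_k` in terms of translations -/

/-- The translation by `c` in each block. -/
def shift (c : ∀ r, ZMod (N r)) (x : Pts N) : Pts N := ⟨x.1, c x.1 + x.2⟩

theorem compat_mk_iff {r s : Fin l} (c d : ∀ r, ZMod (N r)) :
    Compat (N := N) ⟨r, c r⟩ ⟨s, d s⟩ ↔ (r = s → c r = d r) := by
  constructor
  · rintro h rfl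
    exact eq_of_heq (Sigma.mk.inj (h rfl)).2
  · intro h hrs
    obtain rfl : r = s := hrs
    exact congrArg (Sigma.mk r) (h rfl)

/-- The points `i` and `j` differ by blockwise translations, which agree at those pairs of positions
in a same block which are linked by `F`. -/
def LinkedRel {k : ℕ} (F : (Fin k → Fin l) → Fin k → Fin k → Prop) (i j : Fin k → Pts N) : Prop :=
  ∃ c : Fin k → ∀ r, ZMod (N r), (∀ p, i p = shift (c p) (j p)) ∧
    ∀ p q, F (fun p => (j p).1) p q → (j p).1 = (j q).1 → c p (j p).1 = c q (j p).1

/-- Translations preserve blocks, so `F` imposes the same conditions whichever tuple it is read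
from. These are linear in `c`, hence stable under `0`, negation and sums. -/
theorem linkedRel_equivalence {k : ℕ} (F : (Fin k → Fin l) → Fin k → Fin k → Prop) :
    Equivalence (LinkedRel (N := N) F) where
  refl i := ⟨0, fun p => congrArg (Sigma.mk _) (zero_add _).symm, fun _ _ _ _ => rfl⟩
  symm := by
    rintro i j ⟨c, hc, hF⟩
    obtain rfl : i = fun p => shift (c p) (j p) := funext hc
    exact ⟨-c, fun p => congrArg (Sigma.mk _) (neg_add_cancel_left _ _).symm,
      fun p q hpq h => congrArg Neg.neg (hF p q hpq h)⟩
  trans := by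
    rintro i j k ⟨c, hc, hF⟩ ⟨d, hd, hG⟩
    obtain rfl : j = fun p => shift (d p) (k p) := funext hd
    obtain rfl : i = fun p => shift (c p) (shift (d p) (k p)) := funext hc
    exact ⟨c + d, fun p => congrArg (Sigma.mk _) (add_assoc _ _ _).symm,
      fun p q hpq h => congrArg₂ (fun a b : ZMod (N (k p).1) => a + b) (hF p q hpq h) (hG p q hpq h)⟩

theorem LinkedRel.mono {k : ℕ} {F F' : (Fin k → Fin l) → Fin k → Fin k → Prop}
    (h : ∀ b p q, F' b p q → F b p q) {i j : Fin k → Pts N} (hij : LinkedRel F i j) :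
    LinkedRel F' i j :=
  let ⟨c, hc, hF⟩ := hij
  ⟨c, hc, fun p q hpq => hF p q (h _ p q hpq)⟩

variable [∀ r, NeZero (N r)] {Γ : Type u} [Group Γ]

theorem magic_mat_shift (π : FreeProd N →* Γ) (hπ : Function.Surjective π)
    (c : ∀ r, ZMod (N r)) (x : Pts N) :
    (magic π hπ).mat (shift c x) x = proj π ⟨x.1, c x.1⟩ := by
  obtain ⟨r, a⟩ := x
  refine (Matrix.blockDiagonal'_apply_eq (fun r => cyclicMatrix (gen π r)) r _ _).trans ?_
  rw [cyclicMatrix_eq, add_sub_cancel_right]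
  rfl

theorem eq_shift_of_magic_mat_ne_zero (π : FreeProd N →* Γ) (hπ : Function.Surjective π)
    {x y : Pts N} (h : (magic π hπ).mat x y ≠ 0) : ∃ c : ∀ r, ZMod (N r), x = shift c y := by
  obtain ⟨r, a⟩ := x
  obtain ⟨s, b⟩ := y
  obtain rfl : r = s := by
    by_contra hrs
    exact h (Matrix.blockDiagonal'_apply_ne (fun r => cyclicMatrix (gen π r)) _ _ hrs)
  exact ⟨Pi.single r (a - b), by simp [shift]⟩

/-- Only the value of `c p` at the block of `j p` matters; taking a translation of every block
avoids transport between the types `ZMod (N r)`. -/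
theorem magic_rel_iff (π : FreeProd N →* Γ) (hπ : Function.Surjective π) {k : ℕ}
    (i j : Fin k → Pts N) :
    (magic π hπ).Rel k i j ↔ ∃ c : Fin k → ∀ r, ZMod (N r), (∀ p, i p = shift (c p) (j p)) ∧
      (((List.finRange k).map fun p => (⟨(j p).1, c p (j p).1⟩ : Pts N)).map (proj π)).prod ≠ 0 := by
  have key : ∀ c : Fin k → ∀ r, ZMod (N r), (∀ p, i p = shift (c p) (j p)) →
      (List.ofFn fun a => (magic π hπ).mat (i a) (j a)) =
        ((List.finRange k).map fun p => (⟨(j p).1, c p (j p).1⟩ : Pts N)).map (proj π) := by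
    intro c hc
    rw [List.ofFn_eq_map, List.map_map]
    refine List.map_congr_left fun p _ => ?_
    rw [hc, magic_mat_shift]
    rfl
  unfold MagicUnitary.Rel
  constructor
  · intro h
    have : ∀ p, ∃ c : ∀ r, ZMod (N r), i p = shift c (j p) := fun p => by
      refine eq_shift_of_magic_mat_ne_zero π hπ fun h0 => h (List.prod_eq_zero ?_)
      rw [← h0]
      exact List.mem_ofFn.2 ⟨p, rfl⟩
    choose c hc using this
    exact ⟨c, hc, by rwa [← key c hc]⟩
  · rintro ⟨c, hc, h⟩
    rwa [key c hc]

variable (N) in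
/-- Two positions of a sequence of blocks are consecutive, once the blocks of size one are
removed. -/
def Consecutive {k : ℕ} (b : Fin k → Fin l) (p q : Fin k) : Prop :=
  ∃ A B : List (Fin k), (List.finRange k).filter (fun p => N (b p) ≠ 1) = A ++ p :: q :: B

theorem direct_rel_iff {k : ℕ} (i j : Fin k → Pts N) :
    (direct N).Rel k i j ↔ LinkedRel (fun _ _ _ => True) i j := by
  refine (magic_rel_iff _ _ i j).trans (exists_congr fun c => and_congr_right fun _ => ?_)
  rw [prod_proj_direct_ne_zero_iff]
  simp [compat_mk_iff]

theorem free_rel_iff {k : ℕ} (i j : Fin k → Pts N) :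
    (free N).Rel k i j ↔ LinkedRel (Consecutive N) i j := by
  refine (magic_rel_iff _ _ i j).trans (exists_congr fun c => and_congr_right fun _ => ?_)
  rw [prod_proj_free_ne_zero_iff, List.filter_map, List.isChain_map,
    List.isChain_iff_forall_rel_of_append_cons_cons]
  refine forall₂_congr fun p q => ?_
  simp only [compat_mk_iff]
  exact ⟨fun h ⟨A, B, hAB⟩ => h hAB, fun h A B hAB => h ⟨A, B, hAB⟩⟩

/-- Along the blocks `r, s, r` the differences are `1, 0, 0`. The two visits to `r` disagree, which
the direct product forbids; in the free product the visit to `s` separates them. -/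
theorem exists_free_rel_not_direct_rel {r s : Fin l} (hrs : r ≠ s) (hr : 2 ≤ N r)
    (hs : 2 ≤ N s) :
    ∃ i j : Fin 3 → Pts N, (free N).Rel 3 i j ∧ ¬ (direct N).Rel 3 i j := by
  have : Fact (1 < N r) := ⟨hr⟩
  refine ⟨![⟨r, 1⟩, ⟨s, 0⟩, ⟨r, 0⟩], ![⟨r, 0⟩, ⟨s, 0⟩, ⟨r, 0⟩], ?_, ?_⟩
  · rw [free_rel_iff]
    refine ⟨![Pi.single r 1, 0, 0], fun p => ?_, ?_⟩
    · fin_cases p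
      · refine congrArg (Sigma.mk r) ?_
        change (1 : ZMod (N r)) = (Pi.single r 1 : ∀ r, ZMod (N r)) r + 0
        rw [Pi.single_eq_same, add_zero]
      · exact congrArg (Sigma.mk s) (add_zero _).symm
      · exact congrArg (Sigma.mk r) (add_zero _).symm
    rintro p q ⟨A, B, hAB⟩ h
    have hN : ∀ p, N ((![⟨r, 0⟩, ⟨s, 0⟩, ⟨r, 0⟩] : Fin 3 → Pts N) p).1 ≠ 1 := fun p => by
      fin_cases p
      · exact Nat.ne_of_gt hr
      · exact Nat.ne_of_gt hs
      · exact Nat.ne_of_gt hr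
    -- No visited block has size one, so consecutive positions are just `p` and `p + 1`, which lie
    -- in different blocks.
    rw [List.filter_eq_self.2 fun p _ => decide_eq_true (hN p)] at hAB
    have hc := List.isChain_iff_forall_rel_of_append_cons_cons.1
      (show List.IsChain (fun p q : Fin 3 => q = p + 1 ∧ p ≠ 2) (List.finRange 3) by decide) hAB
    obtain ⟨rfl, hp⟩ := hc
    fin_cases p
    · exact absurd h hrs
    · exact absurd h hrs.symm
    · exact absurd rfl hp
  · rw [direct_rel_iff]
    rintro ⟨c, hc, h⟩
    have h02 : c 0 r = c 2 r := h 0 2 trivial rfl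
    have h0 : (1 : ZMod (N r)) = c 0 r + 0 := eq_of_heq (Sigma.mk.inj (hc 0)).2
    have h2 : (0 : ZMod (N r)) = c 2 r + 0 := eq_of_heq (Sigma.mk.inj (hc 2)).2
    rw [h02, ← h2] at h0
    exact one_ne_zero h0

end GroupDual

/-- A strictly coarser equivalence relation on a finite set has strictly fewer classes. -/
theorem ncard_classes_lt_of_coarser {X : Type*} [Finite X] {R S : X → X → Prop}
    (hR : Equivalence R) (hS : Equivalence S) (hRS : ∀ x y, R x y → S x y)
    {x y : X} (hxy : S x y) (hxy' : ¬ R x y) :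
    (Set.range fun x => {y | S x y}).ncard < (Set.range fun x => {y | R x y}).ncard := by
  let f : Set X → Set X := fun C => {y | ∃ x ∈ C, S x y}
  have hf : ∀ x, f {y | R x y} = {y | S x y} := fun x => Set.ext fun y =>
    ⟨fun ⟨z, hz, hzy⟩ => hS.trans (hRS _ _ hz) hzy, fun h => ⟨x, hR.refl x, h⟩⟩
  have himage : (Set.range fun x => {y | S x y}) = f '' Set.range fun x => {y | R x y} := by
    rw [← Set.range_comp]
    exact congrArg Set.range (funext fun x => (hf x).symm)
  rw [himage]
  -- Equal counts would make the merging map `f` injective on classes, yet it identifies the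
  -- distinct `R`-classes of `x` and `y`.
  refine lt_of_le_of_ne (Set.ncard_image_le (Set.toFinite _)) fun h => hxy' ?_
  have hinj := Set.injOn_of_ncard_image_eq h (Set.toFinite _)
  have : {z | R x z} = {z | R y z} := hinj ⟨x, rfl⟩ ⟨y, rfl⟩ (by
    rw [hf, hf]
    exact Set.ext fun z => ⟨fun h => hS.trans (hS.symm hxy) h, fun h => hS.trans hxy h⟩)
  exact this.ge (hR.refl y)

end

theorem proposition6p6 (l : ℕ) (N : Fin l → ℕ) [∀ r, NeZero (N r)] :
    (∀ k : ℕ, Equivalence ((GroupDual.direct N).Rel k) ∧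
      Equivalence ((GroupDual.free N).Rel k)) ∧
    ((∃ r s : Fin l, r ≠ s ∧ 2 ≤ N r ∧ 2 ≤ N s) →
      (GroupDual.direct N).orbitals 3 ≠ (GroupDual.free N).orbitals 3 ∧
      ((GroupDual.free N).orbitals 3).ncard < ((GroupDual.direct N).orbitals 3).ncard) := by

  have hd : ∀ k, Equivalence ((GroupDual.direct N).Rel k) := fun k => by
    rw [show (GroupDual.direct N).Rel k = _ from
      funext₂ fun i j => propext (GroupDual.direct_rel_iff i j)]
    exact GroupDual.linkedRel_equivalence _
  have hf : ∀ k, Equivalence ((GroupDual.free N).Rel k) := fun k => by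
    rw [show (GroupDual.free N).Rel k = _ from
      funext₂ fun i j => propext (GroupDual.free_rel_iff i j)]
    exact GroupDual.linkedRel_equivalence _
  refine ⟨fun k => ⟨hd k, hf k⟩, ?_⟩
  rintro ⟨r, s, hrs, hr, hs⟩
  obtain ⟨i, j, hij, hij'⟩ := GroupDual.exists_free_rel_not_direct_rel hrs hr hs
  have hlt : ((GroupDual.free N).orbitals 3).ncard < ((GroupDual.direct N).orbitals 3).ncard :=
    ncard_classes_lt_of_coarser (hd 3) (hf 3) (fun i j h => (GroupDual.free_rel_iff i j).2
      (((GroupDual.direct_rel_iff i j).1 h).mono fun _ _ _ _ => trivial)) hij hij'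
  -- The collections differ because their cardinalities do.
  exact ⟨fun h => hlt.ne (by rw [h]), hlt⟩
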